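/- **Theorem 2.2 ($\beta$-approximable points on submanifolds of large dimension).** Let $Q$ be a quadratic form in $n+1$ variables with rational coefficients, and let $X=\{[\mathbf x]\in\mathbb P^n(\mathbb R): Q(\mathbf x)=0\}$ be the associated rational quadric hypersurface. Equip $\mathbb P^n(\mathbb R)$ with the metric $\operatorname{dist}([\mathbf v],[\mathbf w])=\frac{\|\mathbf v\wedge\mathbf w\|}{\|\mathbf v\|\,\|\mathbf w\|}$, where $\|\cdot\|$ is the Euclidean norm. Let $\operatorname{rk}_{\mathbb Q}X$ be the maximal dimension of a rational linear subspace of $\mathbb R^{n+1}$ on which $Q$ vanishes identically. Let $X(\mathbb Q)$ be the set of rational points of $X$, and for $v=[\mathbf v]\in X(\mathbb Q)$ with $\mathbf v\in\mathbb Z^{n+1}$ having coprime coordinates put $H(v)=\max_i|v_i|$. The Diophantine exponent of $x\in X$ is $$\beta(x)=\inf\{b>0 : \exists\, c>0\ \ \forall\, v\in X(\mathbb Q),\ \operatorname{dist}(x,v)\ge c\,H(v)^{-b}\}\in[0,\infty]$$ (with $\inf\varnothing=\infty$), and for real $\beta>0$ put $W_\beta=\{x\in X:\beta(x)\ge\beta\}$.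 Let $M$ be a $k$-dimensional (embedded) smooth submanifold of $\mathbb P^n(\mathbb R)$ contained in $X$, with $k\ge\operatorname{rk}_{\mathbb Q}X$. Then, for every real $\beta>0$ such that $M\cap W_\beta$ is nonempty, $$\dim_H(M\cap W_\beta)\le k-(k+1-\operatorname{rk}_{\mathbb Q}X)\Bigl(1-\frac1\beta\Bigr).$$ -/

import Mathlib

open scoped LinearAlgebra.Projectivization ContDiff ENNReal

namespace QuadricApprox

/-- Euclidean space `ℝ^m`. -/
abbrev Vec (m : ℕ) : Type := EuclideanSpace ℝ (Fin m)

/-- Real projective space `ℙⁿ(ℝ)`. -/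
abbrev ProjSpace (n : ℕ) : Type := ℙ ℝ (Vec (n + 1))

/-! ### The metric of projective space -/

/-- The Euclidean norm of `v ∧ w` in `Λ²(ℝ^m)`, computed in the orthonormal basis
`e_i ∧ e_j` with `i < j`. -/
noncomputable def wedgeNorm {m : ℕ} (v w : Vec m) : ℝ :=
  √(∑ p : Fin m × Fin m with p.1 < p.2, (v p.1 * w p.2 - v p.2 * w p.1) ^ 2)

theorem wedgeNorm_nonneg {m : ℕ} (v w : Vec m) : 0 ≤ wedgeNorm v w := Real.sqrt_nonneg _

theorem wedgeNorm_comm {m : ℕ} (v w : Vec m) : wedgeNorm v w = wedgeNorm w v := by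
  unfold wedgeNorm
  congr 1
  exact Finset.sum_congr rfl fun p _ => by ring

theorem wedgeNorm_smul_left {m : ℕ} (a : ℝ) (v w : Vec m) :
    wedgeNorm (a • v) w = |a| * wedgeNorm v w := by
  unfold wedgeNorm
  rw [← Real.sqrt_sq_eq_abs, ← Real.sqrt_mul (sq_nonneg a), Finset.mul_sum]
  congr 1
  refine Finset.sum_congr rfl fun p _ => ?_
  simp only [PiLp.smul_apply, smul_eq_mul]
  ring

theorem wedgeNorm_smul_right {m : ℕ} (a : ℝ) (v w : Vec m) :
    wedgeNorm v (a • w) = |a| * wedgeNorm v w := by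
  rw [wedgeNorm_comm, wedgeNorm_smul_left, wedgeNorm_comm]

/-- Lagrange's identity. -/
theorem wedgeNorm_sq {m : ℕ} (v w : Vec m) :
    wedgeNorm v w ^ 2 = ‖v‖ ^ 2 * ‖w‖ ^ 2 - (inner ℝ v w) ^ 2 := by
  have hall : ∑ p : Fin m × Fin m, (v p.1 * w p.2 - v p.2 * w p.1) ^ 2
      = 2 * (‖v‖ ^ 2 * ‖w‖ ^ 2 - (inner ℝ v w) ^ 2) := by
    rw [EuclideanSpace.real_norm_sq_eq, EuclideanSpace.real_norm_sq_eq, PiLp.inner_apply]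
    simp only [RCLike.inner_apply, conj_trivial]
    have h1 : (∑ i, v i ^ 2) * (∑ j, w j ^ 2)
        = ∑ p : Fin m × Fin m, v p.1 ^ 2 * w p.2 ^ 2 := by
      rw [Finset.sum_mul_sum, Fintype.sum_prod_type]
    have h2 : (∑ i, v i ^ 2) * (∑ j, w j ^ 2)
        = ∑ p : Fin m × Fin m, v p.2 ^ 2 * w p.1 ^ 2 := by
      rw [mul_comm, Finset.sum_mul_sum, Fintype.sum_prod_type]
      exact Finset.sum_congr rfl fun i _ => Finset.sum_congr rfl fun j _ => mul_comm _ _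
    have h3 : (∑ i, w i * v i) ^ 2
        = ∑ p : Fin m × Fin m, (w p.1 * v p.1) * (w p.2 * v p.2) := by
      rw [sq, Finset.sum_mul_sum, Fintype.sum_prod_type]
    have h4 : 2 * ((∑ i, v i ^ 2) * (∑ j, w j ^ 2) - (∑ i, w i * v i) ^ 2)
        = (∑ i, v i ^ 2) * (∑ j, w j ^ 2) + (∑ i, v i ^ 2) * (∑ j, w j ^ 2)
          - 2 * (∑ i, w i * v i) ^ 2 := by ring
    rw [h4]
    nth_rewrite 1 [h1]
    rw [h2, h3, Finset.mul_sum, ← Finset.sum_add_distrib, ← Finset.sum_sub_distrib]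
    exact Finset.sum_congr rfl fun p _ => by ring
  have hle : ∑ p : Fin m × Fin m with ¬ p.1 < p.2, (v p.1 * w p.2 - v p.2 * w p.1) ^ 2
      = ∑ p : Fin m × Fin m with p.1 < p.2, (v p.1 * w p.2 - v p.2 * w p.1) ^ 2 := by
    simp only [Finset.sum_filter, Fintype.sum_prod_type]
    rw [Finset.sum_comm]
    refine Finset.sum_congr rfl fun i _ => Finset.sum_congr rfl fun j _ => ?_
    rcases lt_trichotomy i j with h | h | h
    · rw [if_pos (not_lt.mpr h.le), if_pos h]; ring
    · subst h; simp
    · rw [if_neg (not_not.mpr h), if_neg (not_lt.mpr h.le)]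
  rw [wedgeNorm, Real.sq_sqrt (Finset.sum_nonneg fun _ _ => sq_nonneg _)]
  have := Finset.sum_filter_add_sum_filter_not (Finset.univ : Finset (Fin m × Fin m))
    (fun p => p.1 < p.2) (fun p => (v p.1 * w p.2 - v p.2 * w p.1) ^ 2)
  linarith

/-- `dist(x, y) = ‖v_x ∧ v_y‖ / (‖v_x‖ ‖v_y‖)`, for nonzero vectors `v_x`, `v_y` on the lines
`x`, `y`; by `projDist_mk` the choice of these vectors is immaterial. -/
noncomputable def projDist {n : ℕ} (x y : ProjSpace n) : ℝ :=
  wedgeNorm x.rep y.rep / (‖x.rep‖ * ‖y.rep‖)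

theorem projDist_mk {n : ℕ} (v w : Vec (n + 1)) (hv : v ≠ 0) (hw : w ≠ 0) :
    projDist (Projectivization.mk ℝ v hv) (Projectivization.mk ℝ w hw)
      = wedgeNorm v w / (‖v‖ * ‖w‖) := by
  obtain ⟨a, ha⟩ := Projectivization.exists_smul_eq_mk_rep ℝ v hv
  obtain ⟨b, hb⟩ := Projectivization.exists_smul_eq_mk_rep ℝ w hw
  have ha0 : |(a : ℝ)| ≠ 0 := abs_ne_zero.mpr a.ne_zero
  have hb0 : |(b : ℝ)| ≠ 0 := abs_ne_zero.mpr b.ne_zero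
  have hv0 : ‖v‖ ≠ 0 := norm_ne_zero_iff.mpr hv
  have hw0 : ‖w‖ ≠ 0 := norm_ne_zero_iff.mpr hw
  rw [projDist, ← ha, ← hb, Units.smul_def, Units.smul_def, wedgeNorm_smul_left,
    wedgeNorm_smul_right, norm_smul, norm_smul, Real.norm_eq_abs, Real.norm_eq_abs]
  field_simp

theorem exists_unit_rep {n : ℕ} (x : ProjSpace n) :
    ∃ (v : Vec (n + 1)) (hv : v ≠ 0), ‖v‖ = 1 ∧ x = Projectivization.mk ℝ v hv := by
  have h0 : ‖x.rep‖ ≠ 0 := norm_ne_zero_iff.mpr x.rep_nonzero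
  have h1 : ‖(‖x.rep‖⁻¹ : ℝ) • x.rep‖ = 1 := by
    rw [norm_smul, norm_inv, norm_norm, inv_mul_cancel₀ h0]
  refine ⟨(‖x.rep‖⁻¹ : ℝ) • x.rep, ?_, h1, ?_⟩
  · intro h
    rw [h, norm_zero] at h1
    exact zero_ne_one h1
  · conv_lhs => rw [← x.mk_rep]
    rw [Projectivization.mk_eq_mk_iff']
    exact ⟨‖x.rep‖, by rw [smul_smul, mul_inv_cancel₀ h0, one_smul]⟩

/-- For a unit vector `w`, `‖v ∧ w‖` is the distance of `v` to the line spanned by `w`. -/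
theorem wedgeNorm_eq_norm_sub {m : ℕ} (v w : Vec m) (hw : ‖w‖ = 1) :
    wedgeNorm v w = ‖v - (inner ℝ v w : ℝ) • w‖ := by
  rw [← sq_eq_sq₀ (wedgeNorm_nonneg _ _) (norm_nonneg _), wedgeNorm_sq, norm_sub_sq_real,
    norm_smul, inner_smul_right, hw, Real.norm_eq_abs, mul_one, sq_abs]
  ring

theorem wedgeNorm_le_norm_sub {m : ℕ} (v w : Vec m) (hw : ‖w‖ = 1) (t : ℝ) :
    wedgeNorm v w ≤ ‖v - t • w‖ := by
  rw [← sq_le_sq₀ (wedgeNorm_nonneg _ _) (norm_nonneg _), wedgeNorm_sq, norm_sub_sq_real,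
    norm_smul, inner_smul_right, hw, Real.norm_eq_abs, mul_one, sq_abs]
  nlinarith [sq_nonneg ((inner ℝ v w : ℝ) - t)]

theorem wedgeNorm_triangle {m : ℕ} (a b c : Vec m) (ha : ‖a‖ = 1) (hb : ‖b‖ = 1)
    (hc : ‖c‖ = 1) : wedgeNorm a c ≤ wedgeNorm a b + wedgeNorm b c := by
  have key : a - ((inner ℝ a b : ℝ) * (inner ℝ b c : ℝ)) • c
      = (a - (inner ℝ a b : ℝ) • b) + (inner ℝ a b : ℝ) • (b - (inner ℝ b c : ℝ) • c) := by
    rw [smul_sub, smul_smul]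
    abel
  have hab : |(inner ℝ a b : ℝ)| ≤ 1 := by
    have := abs_real_inner_le_norm a b
    rwa [ha, hb, mul_one] at this
  calc wedgeNorm a c ≤ ‖a - ((inner ℝ a b : ℝ) * (inner ℝ b c : ℝ)) • c‖ :=
        wedgeNorm_le_norm_sub a c hc _
    _ ≤ ‖a - (inner ℝ a b : ℝ) • b‖ + ‖(inner ℝ a b : ℝ) • (b - (inner ℝ b c : ℝ) • c)‖ := by
        rw [key]; exact norm_add_le _ _
    _ = wedgeNorm a b + |(inner ℝ a b : ℝ)| * wedgeNorm b c := by
        rw [norm_smul, Real.norm_eq_abs, wedgeNorm_eq_norm_sub a b hb,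
          wedgeNorm_eq_norm_sub b c hc]
    _ ≤ wedgeNorm a b + wedgeNorm b c := by
        have := mul_le_of_le_one_left (wedgeNorm_nonneg b c) hab
        linarith

noncomputable instance instMetricSpaceProjSpace (n : ℕ) : MetricSpace (ProjSpace n) where
  dist := projDist
  dist_self x := by
    obtain ⟨v, hv, hv1, rfl⟩ := exists_unit_rep x
    have h : wedgeNorm v v ^ 2 = 0 := by
      rw [wedgeNorm_sq, real_inner_self_eq_norm_sq]; ring
    rw [projDist_mk, pow_eq_zero_iff two_ne_zero |>.mp h, zero_div]
  dist_comm x y := by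
    rw [projDist, projDist, wedgeNorm_comm, mul_comm]
  dist_triangle x y z := by
    obtain ⟨a, ha, ha1, rfl⟩ := exists_unit_rep x
    obtain ⟨b, hb, hb1, rfl⟩ := exists_unit_rep y
    obtain ⟨c, hc, hc1, rfl⟩ := exists_unit_rep z
    simp only [projDist_mk, ha1, hb1, hc1, mul_one, div_one]
    exact wedgeNorm_triangle a b c ha1 hb1 hc1
  eq_of_dist_eq_zero := by
    intro x y h
    obtain ⟨a, ha, ha1, rfl⟩ := exists_unit_rep x
    obtain ⟨b, hb, hb1, rfl⟩ := exists_unit_rep y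
    change projDist _ _ = 0 at h
    rw [projDist_mk, ha1, hb1, mul_one, div_one, wedgeNorm_eq_norm_sub a b hb1,
      norm_eq_zero, sub_eq_zero] at h
    rw [Projectivization.mk_eq_mk_iff']
    exact ⟨_, h.symm⟩

/-! ### Smooth submanifolds -/

/-- The standard affine parametrization `ℝⁿ → ℙⁿ(ℝ)` onto the open set where the `i`-th
homogeneous coordinate is nonzero: insert a `1` in position `i`. It is the inverse of the
affine chart `[x] ↦ (x_j / x_i)_{j ≠ i}`. -/
noncomputable def affineParam {n : ℕ} (i : Fin (n + 1)) (y : Fin n → ℝ) : ProjSpace n :=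
  Projectivization.mk ℝ (WithLp.toLp 2 (i.insertNth (1 : ℝ) y : Fin (n + 1) → ℝ)) (by
    intro h
    have h' := congrArg (fun v : Vec (n + 1) => v i) h
    simp at h')

/-- `S` is a `k`-dimensional (embedded, `C^∞`) submanifold of the finite-dimensional space `E`:
around each of its points some smooth diffeomorphism between open subsets of `E` turns it into
a `k`-dimensional linear subspace. -/
def IsSmoothSubmanifold {E : Type*} [NormedAddCommGroup E] [NormedSpace ℝ E]
    (k : ℕ) (S : Set E) : Prop :=
  ∀ p ∈ S, ∃ (e : OpenPartialHomeomorph E E) (V : Submodule ℝ E),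
    p ∈ e.source ∧ ContDiffOn ℝ ∞ e e.source ∧ ContDiffOn ℝ ∞ e.symm e.target ∧
    Module.finrank ℝ V = k ∧ ∀ x ∈ e.source, x ∈ S ↔ e x ∈ V

/-- `M` is a `k`-dimensional smooth submanifold of `ℙⁿ(ℝ)`: it is one in each of the standard
affine charts. -/
def IsSmoothProjSubmanifold {n : ℕ} (k : ℕ) (M : Set (ProjSpace n)) : Prop :=
  ∀ i : Fin (n + 1), IsSmoothSubmanifold k (affineParam i ⁻¹' M)

/-! ### Rational quadrics -/

/-- The quadratic form `Q` on `ℝ^m` is rational: it is given by a matrix of rational numbers. -/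
def IsRationalForm {m : ℕ} (Q : QuadraticForm ℝ (Vec m)) : Prop :=
  ∃ A : Matrix (Fin m) (Fin m) ℚ, ∀ x : Vec m, Q x = ∑ i, ∑ j, (A i j : ℝ) * x i * x j

/-- The projective quadric `X = {[x] : Q(x) = 0}`. -/
def quadric {n : ℕ} (Q : QuadraticForm ℝ (Vec (n + 1))) : Set (ProjSpace n) :=
  {x | ∃ (v : Vec (n + 1)) (hv : v ≠ 0), x = Projectivization.mk ℝ v hv ∧ Q v = 0}

/-- A rational subspace of `ℝ^m`: one that is spanned by vectors with rational coordinates. -/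
def IsRationalSubspace {m : ℕ} (E : Submodule ℝ (Vec m)) : Prop :=
  ∃ S : Set (Fin m → ℚ),
    E = Submodule.span ℝ ((fun q : Fin m → ℚ => (WithLp.toLp 2 fun i => (q i : ℝ) : Vec m)) '' S)

/-- `Q` vanishes identically on `E`. -/
def IsTotallyIsotropic {m : ℕ} (Q : QuadraticForm ℝ (Vec m)) (E : Submodule ℝ (Vec m)) : Prop :=
  ∀ v ∈ E, Q v = 0

/-- The `ℚ`-rank: the maximal dimension of a totally isotropic rational subspace. -/
noncomputable def rankQ {m : ℕ} (Q : QuadraticForm ℝ (Vec m)) : ℕ :=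
  sSup {d | ∃ E : Submodule ℝ (Vec m),
    IsRationalSubspace E ∧ IsTotallyIsotropic Q E ∧ Module.finrank ℝ E = d}

/-- The supremum defining the `ℚ`-rank is attained. -/
theorem rankQ_attained {m : ℕ} (Q : QuadraticForm ℝ (Vec m)) :
    IsGreatest {d | ∃ E : Submodule ℝ (Vec m),
      IsRationalSubspace E ∧ IsTotallyIsotropic Q E ∧ Module.finrank ℝ E = d} (rankQ Q) := by
  have hne : {d | ∃ E : Submodule ℝ (Vec m),
      IsRationalSubspace E ∧ IsTotallyIsotropic Q E ∧ Module.finrank ℝ E = d}.Nonempty :=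
    ⟨0, ⊥, ⟨∅, by simp⟩, fun v hv => by rw [(Submodule.mem_bot ℝ).mp hv, map_zero], by simp⟩
  have hbdd : BddAbove {d | ∃ E : Submodule ℝ (Vec m),
      IsRationalSubspace E ∧ IsTotallyIsotropic Q E ∧ Module.finrank ℝ E = d} := by
    refine ⟨Module.finrank ℝ (Vec m), ?_⟩
    rintro d ⟨E, -, -, rfl⟩
    exact Submodule.finrank_le E
  exact ⟨Nat.sSup_mem hne hbdd, fun d hd => le_csSup hbdd hd⟩

/-! ### Intrinsic Diophantine approximation -/

/-- `v` is the rational point of `ℙⁿ(ℝ)` represented by the integer vector `z` with coprime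
coordinates. Each rational point has exactly two such representatives, `z` and `-z`. -/
def IsPrimitiveRep {n : ℕ} (z : Fin (n + 1) → ℤ) (v : ProjSpace n) : Prop :=
  Finset.univ.gcd z = 1 ∧
    ∃ hz : (WithLp.toLp 2 fun i => (z i : ℝ) : Vec (n + 1)) ≠ 0, v = Projectivization.mk ℝ _ hz

/-- `max_i |z_i|`, which is the height `H(v)` of the rational point `v` represented by the
integer vector `z` with coprime coordinates. -/
def height {n : ℕ} (z : Fin (n + 1) → ℤ) : ℕ :=
  Finset.univ.sup fun i => (z i).natAbs

/-- `dist(x, v) ≥ c H(v)^{-b}` for some `c > 0` and every rational point `v` of the quadric. -/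
def NotApproximable {n : ℕ} (Q : QuadraticForm ℝ (Vec (n + 1))) (b : ℝ) (x : ProjSpace n) :
    Prop :=
  ∃ c : ℝ, 0 < c ∧ ∀ v ∈ quadric Q, ∀ z : Fin (n + 1) → ℤ, IsPrimitiveRep z v →
    c * (height z : ℝ) ^ (-b) ≤ dist x v

/-- The intrinsic Diophantine exponent
`β(x) = inf {b > 0 : ∃ c > 0, ∀ v ∈ X(ℚ), dist(x, v) ≥ c H(v)^{-b}}`, an element of `[0, ∞]`
(with `inf ∅ = ∞`). -/
noncomputable def exponent {n : ℕ} (Q : QuadraticForm ℝ (Vec (n + 1))) (x : ProjSpace n) :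
    ℝ≥0∞ :=
  sInf (ENNReal.ofReal '' {b : ℝ | 0 < b ∧ NotApproximable Q b x})

/-- `W_β`: the points of the quadric whose Diophantine exponent is at least `β`. -/
def approximableSet {n : ℕ} (Q : QuadraticForm ℝ (Vec (n + 1))) (β : ℝ) : Set (ProjSpace n) :=
  {x | x ∈ quadric Q ∧ ENNReal.ofReal β ≤ exponent Q x}

end QuadricApprox

namespace QuadricApprox

/-! Write r for the `ℚ`-rank. The mechanism is a gap principle. If two isotropic integer vectors of
size at most T have directions at distance d, the polar form of Q at them is O(T² d²), because
isotropy removes the first-order term. It also lies in (1/D)ℤ for a fixed D, so it vanishes as soon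
as d ≤ κ/T (`IsRationalForm.exists_polar_eq_zero`). Hence the rational points of height O(T) close
to a set of diameter about κ/T span a totally isotropic rational subspace, of dimension at most r
(`finrank_span_intVec_le`).

For 1 < b < β, an irrational point of W_β is, for infinitely many T = 2^j, within T^(-b) of a
rational point of height at most 2T. Cut a k-dimensional piece of M into about T^k sets of diameter
κ/(4T). In each, the points of this kind lie within T^(-b) of a projective subspace of dimension at
most r - 1, so about T^((b-1)(r-1)) sets of diameter about T^(-b) cover them
(`coveredBy_nearRational_inter`). By Hausdorff–Cantelli the dimension is at most any s with k +
(b-1)(r-1) < b s. Letting b → β gives (r-1) + (k+1-r)/β, which is the stated bound. Rational points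
are countable, and for β ≤ 1 the bound is at least k. -/

/-! ### Coverings and Hausdorff dimension -/

/-- `S` is covered by at most `N` sets, each of diameter at most `δ`. -/
def CoveredBy {X : Type*} [MetricSpace X] (N : ℕ) (δ : ℝ) (S : Set X) : Prop :=
  ∃ F : Finset (Set X), F.card ≤ N ∧ (∀ x ∈ S, ∃ t ∈ F, x ∈ t) ∧
    ∀ t ∈ F, ∀ x ∈ t, ∀ y ∈ t, dist x y ≤ δ

section Covering

variable {X Y : Type*} [MetricSpace X] [MetricSpace Y]

theorem CoveredBy.mono {N N' : ℕ} {δ δ' : ℝ} {S S' : Set X} (h : CoveredBy N δ S)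
    (hN : N ≤ N') (hδ : δ ≤ δ') (hS : S' ⊆ S) : CoveredBy N' δ' S' := by
  obtain ⟨F, hF, hc, hd⟩ := h
  exact ⟨F, hF.trans hN, fun x hx => hc x (hS hx),
    fun t ht x hx y hy => (hd t ht x hx y hy).trans hδ⟩

theorem CoveredBy.image {N : ℕ} {δ : ℝ} {S : Set X} (h : CoveredBy N δ S) {f : X → Y}
    {K : NNReal} (hf : LipschitzOnWith K f S) : CoveredBy N (K * δ) (f '' S) := by
  classical
  obtain ⟨F, hF, hc, hd⟩ := h
  refine ⟨F.image fun t => f '' (t ∩ S), Finset.card_image_le.trans hF, ?_, ?_⟩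
  · rintro _ ⟨x, hx, rfl⟩
    obtain ⟨t, ht, hxt⟩ := hc x hx
    exact ⟨_, Finset.mem_image_of_mem _ ht, x, ⟨hxt, hx⟩, rfl⟩
  · intro t ht
    obtain ⟨u, hu, rfl⟩ := Finset.mem_image.mp ht
    rintro _ ⟨x, ⟨hx, hxS⟩, rfl⟩ _ ⟨y, ⟨hy, hyS⟩, rfl⟩
    exact (hf.dist_le_mul x hxS y hyS).trans
      (mul_le_mul_of_nonneg_left (hd u hu x hx y hy) K.coe_nonneg)

theorem CoveredBy.thicken {N : ℕ} {δ : ℝ} {S : Set X} (h : CoveredBy N δ S) (ε : ℝ) :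
    CoveredBy N (δ + 2 * ε) {x | ∃ y ∈ S, dist x y ≤ ε} := by
  classical
  obtain ⟨F, hF, hc, hd⟩ := h
  refine ⟨F.image fun t => {x | ∃ y ∈ t, dist x y ≤ ε}, Finset.card_image_le.trans hF, ?_, ?_⟩
  · rintro x ⟨y, hy, hxy⟩
    obtain ⟨t, ht, hyt⟩ := hc y hy
    exact ⟨_, Finset.mem_image_of_mem _ ht, y, hyt, hxy⟩
  · intro t ht
    obtain ⟨u, hu, rfl⟩ := Finset.mem_image.mp ht
    rintro x ⟨x', hx', hx⟩ y ⟨y', hy', hy⟩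
    have h1 := dist_triangle4_right x y x' y'
    have h2 := hd u hu x' hx' y' hy'
    linarith

/-- Refining a covering: if each small piece of `S` can be covered, so can `S`. -/
theorem CoveredBy.refine {N N' : ℕ} {δ δ' : ℝ} {S A : Set X} (h : CoveredBy N δ S)
    (hA : A ⊆ S)
    (H : ∀ t : Set X, (∀ x ∈ t, ∀ y ∈ t, dist x y ≤ δ) → CoveredBy N' δ' (A ∩ t)) :
    CoveredBy (N * N') δ' A := by
  classical
  obtain ⟨F, hF, hc, hd⟩ := h
  have hG : ∀ t : Set X, ∃ G : Finset (Set X), t ∈ F → G.card ≤ N' ∧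
      (∀ x ∈ A ∩ t, ∃ u ∈ G, x ∈ u) ∧ ∀ u ∈ G, ∀ x ∈ u, ∀ y ∈ u, dist x y ≤ δ' := by
    intro t
    by_cases ht : t ∈ F
    · obtain ⟨G, hG⟩ := H t (hd t ht)
      exact ⟨G, fun _ => hG⟩
    · exact ⟨∅, fun h => absurd h ht⟩
  choose G hG using hG
  refine ⟨F.biUnion G, ?_, ?_, ?_⟩
  · exact (Finset.card_biUnion_le_card_mul _ _ _ fun t ht => (hG t ht).1).trans
      (Nat.mul_le_mul_right _ hF)
  · intro x hx
    obtain ⟨t, ht, hxt⟩ := hc x (hA hx)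
    obtain ⟨u, hu, hxu⟩ := (hG t ht).2.1 x ⟨hx, hxt⟩
    exact ⟨u, Finset.mem_biUnion.mpr ⟨t, ht, hu⟩, hxu⟩
  · intro u hu
    obtain ⟨t, ht, hut⟩ := Finset.mem_biUnion.mp hu
    exact (hG t ht).2.2 u hut

/-- Cutting a cube of side `2R` into `N^d` cubes of side `2R/N`. -/
theorem coveredBy_closedBall_pi (d N : ℕ) (hN : 0 < N) (R : ℝ) (hR : 0 ≤ R) :
    CoveredBy (N ^ d) (2 * R / N) (Metric.closedBall (0 : Fin d → ℝ) R) := by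
  classical
  have hN' : (0 : ℝ) < N := by exact_mod_cast hN
  rcases hR.eq_or_lt with rfl | hR
  -- A ball of radius 0 is treated apart because the subdivision divides by the side 2R/N.
  · refine ⟨{{0}}, ?_, ?_, ?_⟩
    · simpa using Nat.one_le_pow _ _ hN
    · intro x hx
      simpa using hx
    · simp
  let P : (Fin d → Fin N) → Set (Fin d → ℝ) := fun m =>
    {c | ∀ i, 2 * R / N * (m i : ℕ) ≤ c i + R ∧ c i + R ≤ 2 * R / N * ((m i : ℕ) + 1)}
  have hs : 0 < 2 * R / N := by positivity
  refine ⟨Finset.univ.image P, ?_, ?_, ?_⟩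
  · refine Finset.card_image_le.trans ?_
    simp
  · intro x hx
    have hx' : ∀ i, |x i| ≤ R := fun i => by
      have h1 := norm_le_pi_norm x i
      have h2 : ‖x‖ ≤ R := by simpa using hx
      exact h1.trans h2
    have hm : ∀ i, ∃ m : Fin N, 2 * R / N * (m : ℕ) ≤ x i + R ∧
        x i + R ≤ 2 * R / N * ((m : ℕ) + 1) := by
      intro i
      obtain ⟨hl, hu⟩ := abs_le.mp (hx' i)
      have h0 : 0 ≤ (x i + R) / (2 * R / N) := div_nonneg (by linarith) hs.le
      by_cases hlt : ⌊(x i + R) / (2 * R / N)⌋₊ < N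
      · refine ⟨⟨_, hlt⟩, ?_, ?_⟩
        · have := Nat.floor_le h0
          rw [le_div_iff₀ hs] at this
          linarith
        · have := (Nat.lt_floor_add_one ((x i + R) / (2 * R / N))).le
          rw [div_le_iff₀ hs] at this
          linarith
      · have h1 : (N : ℝ) ≤ (x i + R) / (2 * R / N) :=
          (Nat.le_floor_iff h0).mp (not_lt.mp hlt)
        rw [le_div_iff₀ hs, mul_div_cancel₀ _ hN'.ne'] at h1
        -- Only the upper face x i = R gives an index ≥ N; it is assigned to the last slab.
        refine ⟨⟨N - 1, Nat.sub_lt hN one_pos⟩, ?_, ?_⟩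
        · refine le_trans ?_ h1
          rw [div_mul_eq_mul_div, div_le_iff₀ hN']
          have : ((N - 1 : ℕ) : ℝ) ≤ N := by exact_mod_cast Nat.sub_le _ _
          exact mul_le_mul_of_nonneg_left this (by positivity)
        · have : ((N - 1 : ℕ) : ℝ) + 1 = N := by exact_mod_cast Nat.sub_add_cancel hN
          simp only [this]
          rw [div_mul_cancel₀ _ hN'.ne']
          linarith
    choose m hm using hm
    exact ⟨P m, Finset.mem_image_of_mem _ (Finset.mem_univ _), hm⟩
  · intro t ht
    obtain ⟨m, -, rfl⟩ := Finset.mem_image.mp ht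
    intro x hx y hy
    refine (dist_pi_le_iff hs.le).mpr fun i => ?_
    obtain ⟨h1, h2⟩ := hx i
    obtain ⟨h3, h4⟩ := hy i
    rw [Real.dist_eq, abs_le]
    constructor <;> linarith

open Filter Topology in
/-- The Hausdorff–Cantelli lemma for coverings. -/
theorem dimH_le_of_frequently_mem {S : Set X} {s : ℝ} (hs : 0 ≤ s) {N : ℕ → ℕ} {δ : ℕ → ℝ}
    (hδ0 : ∀ j, 0 ≤ δ j) (hδa : Antitone δ) (hδ : Tendsto δ atTop (𝓝 0))
    (hsum : Summable fun j => (N j : ℝ) * δ j ^ s) (A : ℕ → Set X)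
    (hA : ∀ᶠ j in atTop, CoveredBy (N j) (δ j) (A j))
    (hS : ∀ x ∈ S, ∃ᶠ j in atTop, x ∈ A j) : dimH S ≤ ENNReal.ofReal s := by
  borelize X
  obtain ⟨J, hJ⟩ := eventually_atTop.mp hA
  -- Below the threshold J the family is a dummy; only tails matter.
  have hF : ∀ j, ∃ F : Finset (Set X), J ≤ j → F.card ≤ N j ∧ (∀ x ∈ A j, ∃ t ∈ F, x ∈ t) ∧
      ∀ t ∈ F, ∀ x ∈ t, ∀ y ∈ t, dist x y ≤ δ j := by
    intro j
    by_cases h : J ≤ j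
    · obtain ⟨F, hF⟩ := hJ j h
      exact ⟨F, fun _ => hF⟩
    · exact ⟨∅, fun h' => absurd h' h⟩
  choose F hF using hF
  have hdiam : ∀ j, J ≤ j → ∀ t ∈ F j, Metric.ediam t ≤ ENNReal.ofReal (δ j) := by
    intro j hj t ht
    refine Metric.ediam_le fun x hx y hy => ?_
    rw [edist_dist]
    exact ENNReal.ofReal_le_ofReal ((hF j hj).2.2 t ht x hx y hy)
  have hmeas : MeasureTheory.Measure.hausdorffMeasure s S ≤ 0 := by
    -- For every m ≥ J, all the coverings with index at least m together cover S. The measure is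
    -- thus bounded by the tails of a convergent series, which tend to 0.
    have key := MeasureTheory.Measure.hausdorffMeasure_le_liminf_tsum (X := X)
      (ι := fun m : ℕ => (i : ℕ) × {t // t ∈ F (i + m)}) s S (l := atTop)
      (fun m => ENNReal.ofReal (δ m))
      (by simpa using ENNReal.tendsto_ofReal hδ) (fun m p => p.2.1)
      (by
        filter_upwards [eventually_ge_atTop J] with m hm
        rintro ⟨i, t, ht⟩
        exact (hdiam _ (by omega) t ht).trans (ENNReal.ofReal_le_ofReal (hδa (by omega))))
      (by
        filter_upwards [eventually_ge_atTop J] with m hm x hx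
        obtain ⟨j, hj, hxj⟩ := (frequently_atTop.mp (hS x hx)) m
        obtain ⟨t, ht, hxt⟩ := (hF j (hm.trans hj)).2.1 x hxj
        have hjm : j - m + m = j := Nat.sub_add_cancel hj
        exact Set.mem_iUnion.mpr ⟨⟨j - m, t, by rw [hjm]; exact ht⟩, hxt⟩)
    refine key.trans ?_
    set a : ℕ → ℝ≥0∞ := fun j => ENNReal.ofReal ((N j : ℝ) * δ j ^ s) with ha
    have hfin : ∑' j, a j ≠ ⊤ := by
      rw [ha, ← ENNReal.ofReal_tsum_of_nonneg _ hsum]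
      · exact ENNReal.ofReal_ne_top
      · exact fun j => mul_nonneg (Nat.cast_nonneg _) (Real.rpow_nonneg (hδ0 j) _)
    have hlim := ENNReal.tendsto_sum_nat_add a hfin
    rw [← hlim.liminf_eq]
    refine liminf_le_liminf ?_
    filter_upwards [eventually_ge_atTop J] with m hm
    rw [ENNReal.tsum_sigma']
    refine ENNReal.tsum_le_tsum fun i => ?_
    rw [tsum_fintype]
    have hb : ∀ t : {t // t ∈ F (i + m)},
        Metric.ediam t.1 ^ s ≤ ENNReal.ofReal (δ (i + m) ^ s) := by
      rintro ⟨t, ht⟩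
      rw [← ENNReal.ofReal_rpow_of_nonneg (hδ0 _) hs]
      exact ENNReal.rpow_le_rpow (hdiam _ (by omega) t ht) hs
    refine (Finset.sum_le_sum fun t _ => hb t).trans ?_
    rw [Finset.sum_const, nsmul_eq_mul, ha]
    simp only
    rw [ENNReal.ofReal_mul (Nat.cast_nonneg _), ENNReal.ofReal_natCast]
    gcongr
    simpa using (hF (i + m) (by omega)).1
  have := dimH_le_of_hausdorffMeasure_ne_top (s := S) (d := s.toNNReal) (by
    rw [Real.coe_toNNReal s hs]
    exact (hmeas.trans_lt ENNReal.zero_lt_top).ne)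
  exact this

end Covering

end QuadricApprox

namespace QuadricApprox

/-! ### The projection to projective space -/

theorem dist_mk {n : ℕ} (v w : Vec (n + 1)) (hv : v ≠ 0) (hw : w ≠ 0) :
    dist (Projectivization.mk ℝ v hv) (Projectivization.mk ℝ w hw)
      = wedgeNorm v w / (‖v‖ * ‖w‖) :=
  projDist_mk v w hv hw

/-- Since v ∧ w = (v - w) ∧ w; the difference of the squares is (‖w‖² - ⟨v, w⟩)². -/
theorem wedgeNorm_le_norm_sub_mul {m : ℕ} (v w : Vec m) : wedgeNorm v w ≤ ‖v - w‖ * ‖w‖ := by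
  rw [← sq_le_sq₀ (wedgeNorm_nonneg _ _) (by positivity), wedgeNorm_sq, mul_pow, norm_sub_sq_real]
  nlinarith [sq_nonneg (‖w‖ ^ 2 - inner ℝ v w)]

open Classical in
/-- The projection `ℝ^{n+1} ∖ {0} → ℙⁿ(ℝ)`, extended to the origin by an arbitrary value. -/
noncomputable def toProj {n : ℕ} (v : Vec (n + 1)) : ProjSpace n :=
  if h : v = 0 then affineParam 0 0 else Projectivization.mk ℝ v h

theorem toProj_of_ne_zero {n : ℕ} {v : Vec (n + 1)} (h : v ≠ 0) :
    toProj v = Projectivization.mk ℝ v h := dif_neg h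

theorem lipschitzOnWith_toProj {n : ℕ} :
    LipschitzOnWith 1 (toProj : Vec (n + 1) → ProjSpace n) {v | 1 ≤ ‖v‖} := by
  refine LipschitzOnWith.of_dist_le_mul fun v hv w hw => ?_
  have hv' : 1 ≤ ‖v‖ := hv
  have hw' : 1 ≤ ‖w‖ := hw
  have hv0 : v ≠ 0 := norm_pos_iff.mp (by linarith)
  have hw0 : w ≠ 0 := norm_pos_iff.mp (by linarith)
  rw [toProj_of_ne_zero hv0, toProj_of_ne_zero hw0, dist_mk, NNReal.coe_one, one_mul, dist_eq_norm,
    div_le_iff₀ (by positivity)]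
  refine (wedgeNorm_le_norm_sub_mul v w).trans ?_
  have : ‖v - w‖ * ‖w‖ ≤ ‖v‖ * (‖v - w‖ * ‖w‖) := le_mul_of_one_le_left (by positivity) hv'
  linarith

/-- A small ball of a projective subspace is covered by as many sets as a ball of its
dimension. -/
theorem coveredBy_subspace {n : ℕ} (E : Submodule ℝ (Vec (n + 1))) (u : Vec (n + 1)) (hu : u ∈ E)
    (hu1 : ‖u‖ = 1) (hu0 : u ≠ 0) (N : ℕ) (hN : 0 < N) (ρ : ℝ) (hρ0 : 0 ≤ ρ) (hρ : ρ ≤ 1 / 2) :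
    CoveredBy (N ^ (Module.finrank ℝ E - 1)) (4 * (n + 1) * (ρ / N))
      {y | ∃ e ∈ E, ∃ he : e ≠ 0, y = Projectivization.mk ℝ e he ∧
        dist y (Projectivization.mk ℝ u hu0) ≤ ρ} := by
  -- The affine slice u + W parametrizes the neighbourhood of [u] in the projective space of E, with
  -- one dimension fewer than E. It avoids the open unit ball, where `toProj` is not controlled.
  set W : Submodule ℝ (Vec (n + 1)) := E ⊓ (Submodule.span ℝ {u})ᗮ with hW
  have hWu : ∀ w ∈ W, inner ℝ w u = 0 := by
    intro w hw
    exact Submodule.mem_orthogonal_singleton_iff_inner_left.mp hw.2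
  have hlt : W < E := by
    refine lt_of_le_of_ne inf_le_left fun h => ?_
    have h1 := hWu u (h ▸ hu)
    rw [real_inner_self_eq_norm_sq, hu1] at h1
    norm_num at h1
  have hd : Module.finrank ℝ W ≤ Module.finrank ℝ E - 1 := by
    have := Submodule.finrank_lt_finrank_of_lt hlt
    omega
  have hdn : Module.finrank ℝ W ≤ n + 1 := by
    simpa using Submodule.finrank_le W
  set b := stdOrthonormalBasis ℝ W with hb
  let L : (Fin (Module.finrank ℝ W) → ℝ) → Vec (n + 1) := fun c => u + ((∑ i, c i • b i : W) : Vec (n + 1))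
  have hL1 : ∀ c, 1 ≤ ‖L c‖ := by
    intro c
    have h1 : inner ℝ (L c) u = 1 := by
      rw [inner_add_left, hWu _ (SetLike.coe_mem _), real_inner_self_eq_norm_sq, hu1]
      norm_num
    have h2 := real_inner_le_norm (L c) u
    rw [h1, hu1, mul_one] at h2
    exact h2
  have hL : LipschitzWith (n + 1) L := by
    refine LipschitzWith.of_dist_le_mul fun c c' => ?_
    have h1 : L c - L c' = ((∑ i, (c i - c' i) • b i : W) : Vec (n + 1)) := by
      simp only [L, sub_smul, Finset.sum_sub_distrib, Submodule.coe_sub]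
      abel
    rw [dist_eq_norm, h1, Submodule.norm_coe]
    have h2 : ∀ i ∈ Finset.univ, ‖(c i - c' i) • b i‖ ≤ dist c c' := by
      intro i _
      rw [norm_smul, b.norm_eq_one, mul_one, ← dist_eq_norm]
      exact dist_le_pi_dist c c' i
    refine (norm_sum_le_of_le _ h2).trans ?_
    rw [Finset.sum_const, Finset.card_univ, Fintype.card_fin, nsmul_eq_mul]
    refine mul_le_mul_of_nonneg_right ?_ dist_nonneg
    push_cast
    exact_mod_cast hdn
  have hg : LipschitzOnWith (1 * (n + 1)) (toProj ∘ L) (Metric.closedBall 0 (2 * ρ)) :=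
    lipschitzOnWith_toProj.comp hL.lipschitzOnWith fun c _ => hL1 c
  refine ((coveredBy_closedBall_pi (Module.finrank ℝ W) N hN (2 * ρ) (by linarith)).image hg).mono
    (Nat.pow_le_pow_right hN hd) (le_of_eq (by push_cast; ring)) ?_
  rintro y ⟨e, he, he0, rfl, hy⟩
  set t : ℝ := inner ℝ e u with ht
  have hepos : 0 < ‖e‖ := norm_pos_iff.mpr he0
  rw [dist_mk, hu1, mul_one, div_le_iff₀ hepos] at hy
  have hy2 : ‖e‖ ^ 2 - t ^ 2 ≤ ρ ^ 2 * ‖e‖ ^ 2 := by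
    have h1 := pow_le_pow_left₀ (wedgeNorm_nonneg _ _) hy 2
    rw [wedgeNorm_sq, hu1, mul_pow] at h1
    linarith
  have hρ2 : ρ ^ 2 ≤ 1 / 4 := by nlinarith
  have he2 : 0 < ‖e‖ ^ 2 := by positivity
  have ht2 : ‖e‖ ^ 2 ≤ 4 * t ^ 2 := by nlinarith
  have ht0 : t ≠ 0 := by
    rintro h
    rw [h] at ht2
    linarith
  have hwu : inner ℝ (t⁻¹ • e - u) u = 0 := by
    rw [inner_sub_left, inner_smul_left, ← ht, real_inner_self_eq_norm_sq, hu1]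
    simp [ht0]
  have hwW : t⁻¹ • e - u ∈ W :=
    ⟨E.sub_mem (E.smul_mem _ he) hu, Submodule.mem_orthogonal_singleton_iff_inner_left.mpr hwu⟩
  set w : W := ⟨t⁻¹ • e - u, hwW⟩ with hw
  -- This norm is the tangent of the angle between e and u, whose sine is at most ρ ≤ 1/2; hence the
  -- cube of radius 2ρ above.
  have hwn : ‖w‖ ≤ 2 * ρ := by
    rw [Submodule.coe_norm, ← sq_le_sq₀ (norm_nonneg _) (by linarith)]
    have h1 : ‖t⁻¹ • e - u‖ ^ 2 = t⁻¹ ^ 2 * ‖e‖ ^ 2 - 1 := by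
      rw [norm_sub_sq_real, norm_smul, inner_smul_left, ← ht, hu1, mul_pow, Real.norm_eq_abs,
        sq_abs]
      simp [ht0]
      ring
    rw [hw]
    simp only
    rw [h1, inv_pow, inv_mul_eq_div, sub_le_iff_le_add, div_le_iff₀ (by positivity)]
    nlinarith [sq_nonneg ρ]
  refine ⟨fun i => b.repr w i, ?_, ?_⟩
  · rw [mem_closedBall_zero_iff, pi_norm_le_iff_of_nonneg (by linarith)]
    intro i
    rw [b.repr_apply_apply]
    refine (norm_inner_le_norm _ _).trans ?_
    rw [b.norm_eq_one, one_mul]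
    exact hwn
  · have h1 : L (fun i => b.repr w i) = t⁻¹ • e := by
      simp only [L]
      rw [b.sum_repr, hw]
      simp
    rw [Function.comp_apply, h1, toProj_of_ne_zero (smul_ne_zero (inv_ne_zero ht0) he0),
      Projectivization.mk_eq_mk_iff']
    exact ⟨t⁻¹, rfl⟩

/-! ### Rational points that are close to each other -/

/-- The vector of `ℝ^m` with given integer coordinates. -/
noncomputable def intVec {m : ℕ} (z : Fin m → ℤ) : Vec m := WithLp.toLp 2 fun i => (z i : ℝ)

/-- The product of the denominators of all matrix entries works. This is the discreteness that turns
a small value into zero. -/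
theorem IsRationalForm.exists_denominator {m : ℕ} {Q : QuadraticForm ℝ (Vec m)}
    (hQ : IsRationalForm Q) :
    ∃ D : ℝ, 0 < D ∧ ∀ z : Fin m → ℤ, ∃ a : ℤ, D * Q (intVec z) = a := by
  obtain ⟨A, hA⟩ := hQ
  set D : ℕ := ∏ p : Fin m × Fin m, (A p.1 p.2).den with hD
  have hint : ∀ i j, ∃ a : ℤ, (D : ℝ) * (A i j : ℝ) = a := by
    intro i j
    obtain ⟨c, hc⟩ := Finset.dvd_prod_of_mem (fun p : Fin m × Fin m => (A p.1 p.2).den)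
      (Finset.mem_univ (i, j))
    refine ⟨c * (A i j).num, ?_⟩
    have h1 : (D : ℚ) * A i j = c * (A i j).num := by
      rw [hD, hc, ← Rat.den_mul_eq_num (A i j)]
      push_cast
      ring
    exact_mod_cast h1
  choose a ha using hint
  refine ⟨D, ?_, fun z => ⟨∑ i, ∑ j, a i j * z i * z j, ?_⟩⟩
  · exact_mod_cast Finset.prod_pos fun (p : Fin m × Fin m) _ => (A p.1 p.2).den_pos
  · rw [hA]
    push_cast
    simp only [Finset.mul_sum, ← ha]
    refine Finset.sum_congr rfl fun i _ => Finset.sum_congr rfl fun j _ => ?_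
    simp only [intVec]
    ring

theorem IsRationalForm.exists_bound {m : ℕ} {Q : QuadraticForm ℝ (Vec m)}
    (hQ : IsRationalForm Q) : ∃ C : ℝ, 0 < C ∧ ∀ x, |Q x| ≤ C * ‖x‖ ^ 2 := by
  obtain ⟨A, hA⟩ := hQ
  refine ⟨∑ i, ∑ j, |(A i j : ℝ)| + 1, by positivity, fun x => ?_⟩
  have hx : ∀ i, |x i| ≤ ‖x‖ := fun i => PiLp.norm_apply_le x i
  have h : |Q x| ≤ (∑ i, ∑ j, |(A i j : ℝ)|) * ‖x‖ ^ 2 := by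
    rw [hA, Finset.sum_mul]
    refine (Finset.abs_sum_le_sum_abs _ _).trans (Finset.sum_le_sum fun i _ => ?_)
    rw [Finset.sum_mul]
    refine (Finset.abs_sum_le_sum_abs _ _).trans (Finset.sum_le_sum fun j _ => ?_)
    rw [abs_mul, abs_mul, mul_assoc, sq]
    have := mul_le_mul (hx i) (hx j) (abs_nonneg _) (norm_nonneg _)
    exact mul_le_mul_of_nonneg_left this (abs_nonneg _)
  nlinarith [sq_nonneg ‖x‖]

theorem norm_intVec_le {m : ℕ} (z : Fin m → ℤ) (T : ℝ) (hT : ∀ i, |(z i : ℝ)| ≤ T) (hT0 : 0 ≤ T) :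
    ‖intVec z‖ ≤ m * T := by
  rw [← sq_le_sq₀ (norm_nonneg _) (by positivity), EuclideanSpace.real_norm_sq_eq]
  have h1 : ∑ i, (intVec z) i ^ 2 ≤ ∑ _i : Fin m, T ^ 2 := by
    refine Finset.sum_le_sum fun i _ => ?_
    exact sq_le_sq' (abs_le.mp (hT i)).1 (abs_le.mp (hT i)).2
  refine h1.trans ?_
  rw [Finset.sum_const, Finset.card_univ, Fintype.card_fin, nsmul_eq_mul, mul_pow]
  refine mul_le_mul_of_nonneg_right ?_ (sq_nonneg _)
  exact_mod_cast Nat.le_self_pow two_ne_zero m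

/-- With t = ⟨u, v⟩, isotropy of both vectors gives Q(u - t v) = -t · polar(u, v), while ‖u - t v‖ =
‖u ∧ v‖. Closeness keeps |t| ≥ 1/2, so t can be divided out. The quadratic order in the distance is
what makes the scale 1/T sufficient. -/
theorem abs_polar_le {m : ℕ} {Q : QuadraticForm ℝ (Vec m)} {C : ℝ}
    (hC : ∀ x, |Q x| ≤ C * ‖x‖ ^ 2) (u v : Vec m) (hu : ‖u‖ = 1) (hv : ‖v‖ = 1)
    (hQu : Q u = 0) (hQv : Q v = 0) (huv : wedgeNorm u v ≤ 1 / 2) :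
    |QuadraticMap.polar Q u v| ≤ 2 * C * wedgeNorm u v ^ 2 := by
  set t : ℝ := inner ℝ u v with ht
  have h1 : Q (u - t • v) = -(t * QuadraticMap.polar Q u v) := by
    have h2 : QuadraticMap.polar Q u (-(t • v)) = -(t * QuadraticMap.polar Q u v) := by
      rw [QuadraticMap.polar_neg_right, QuadraticMap.polar_smul_right, smul_eq_mul]
    rw [QuadraticMap.polar, ← sub_eq_add_neg, QuadraticMap.map_neg, QuadraticMap.map_smul, hQu,
      hQv] at h2
    simpa using h2
  have h2 := hC (u - t • v)
  rw [h1, abs_neg, abs_mul, ← wedgeNorm_eq_norm_sub u v hv] at h2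
  have h3 : wedgeNorm u v ^ 2 = 1 - t ^ 2 := by rw [wedgeNorm_sq, hu, hv]; ring
  have h4 : 1 / 2 ≤ |t| := by
    have h5 : wedgeNorm u v ^ 2 ≤ 1 / 4 := by nlinarith [wedgeNorm_nonneg u v]
    nlinarith [abs_nonneg t, sq_abs t]
  nlinarith [mul_le_mul_of_nonneg_right h4 (abs_nonneg (QuadraticMap.polar Q u v))]

/-- Isotropic integer vectors of size at most `T` whose directions are at distance at most
`κ / T` are orthogonal. -/
theorem IsRationalForm.exists_polar_eq_zero {n : ℕ} {Q : QuadraticForm ℝ (Vec (n + 1))}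
    (hQ : IsRationalForm Q) :
    ∃ κ : ℝ, 0 < κ ∧ κ ≤ 1 / 2 ∧ ∀ T : ℝ, 1 ≤ T → ∀ z z' : Fin (n + 1) → ℤ,
      (∀ i, |(z i : ℝ)| ≤ T) → (∀ i, |(z' i : ℝ)| ≤ T) → Q (intVec z) = 0 → Q (intVec z') = 0 →
      ∀ (hz : intVec z ≠ 0) (hz' : intVec z' ≠ 0),
      dist (Projectivization.mk ℝ _ hz) (Projectivization.mk ℝ _ hz') ≤ κ / T →
      QuadraticMap.polar Q (intVec z) (intVec z') = 0 := by
  obtain ⟨D, hD, hint⟩ := hQ.exists_denominator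
  obtain ⟨C, hC, hbound⟩ := hQ.exists_bound
  set B : ℝ := 2 * C * D * (n + 1) ^ 2 with hB
  have hB0 : 0 < B := by positivity
  refine ⟨1 / (2 * (B + 1)), by positivity, ?_, ?_⟩
  · rw [div_le_div_iff₀ (by positivity) (by norm_num)]
    linarith
  intro T hT z z' hzT hzT' hQz hQz' hz hz' hdist
  set κ : ℝ := 1 / (2 * (B + 1)) with hκ
  have hκ0 : 0 < κ := by positivity
  have hκB : B * κ < 1 := by
    rw [hκ, mul_one_div, div_lt_one (by positivity)]
    linarith
  have hκ1 : κ ≤ 1 / 2 := by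
    rw [hκ, div_le_div_iff₀ (by positivity) (by norm_num)]
    linarith
  have hp : 0 < ‖intVec z‖ := norm_pos_iff.mpr hz
  have hp' : 0 < ‖intVec z'‖ := norm_pos_iff.mpr hz'
  set u := ‖intVec z‖⁻¹ • intVec z with hu
  set u' := ‖intVec z'‖⁻¹ • intVec z' with hu'
  have hu1 : ‖u‖ = 1 := norm_smul_inv_norm hz
  have hu1' : ‖u'‖ = 1 := norm_smul_inv_norm hz'
  have hd : wedgeNorm u u' ≤ κ / T := by
    rw [dist_mk] at hdist
    rw [hu, hu', wedgeNorm_smul_left, wedgeNorm_smul_right, abs_of_pos (by positivity),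
      abs_of_pos (by positivity)]
    refine le_of_eq_of_le ?_ hdist
    field_simp
  have hT0 : 0 < T := by linarith
  have hd2 : wedgeNorm u u' ≤ 1 / 2 :=
    hd.trans ((div_le_self hκ0.le hT).trans hκ1)
  have hpol : QuadraticMap.polar Q (intVec z) (intVec z')
      = ‖intVec z‖ * ‖intVec z'‖ * QuadraticMap.polar Q u u' := by
    rw [hu, hu', QuadraticMap.polar_smul_left, QuadraticMap.polar_smul_right, smul_eq_mul,
      smul_eq_mul]
    field_simp
  have habs := abs_polar_le hbound u u' hu1 hu1' (by rw [hu, QuadraticMap.map_smul, hQz, smul_zero])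
    (by rw [hu', QuadraticMap.map_smul, hQz', smul_zero]) hd2
  -- By isotropy the polar form is just Q(z + z').
  obtain ⟨a, ha⟩ : ∃ a : ℤ, D * QuadraticMap.polar Q (intVec z) (intVec z') = a := by
    obtain ⟨a, ha⟩ := hint (z + z')
    have hadd : intVec (z + z') = intVec z + intVec z' := by
      ext i
      simp [intVec]
    refine ⟨a, ?_⟩
    rw [QuadraticMap.polar, hQz, hQz', sub_zero, sub_zero, ← hadd, ha]
  have hsmall : |(a : ℝ)| < 1 := by
    rw [← ha, hpol, abs_mul, abs_mul, abs_of_pos hD, abs_of_pos (mul_pos hp hp')]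
    have h1 := norm_intVec_le z T hzT hT0.le
    have h2 := norm_intVec_le z' T hzT' hT0.le
    have h3 : wedgeNorm u u' ^ 2 ≤ (κ / T) ^ 2 := pow_le_pow_left₀ (wedgeNorm_nonneg _ _) hd 2
    push_cast at h1 h2
    -- The two factors T from the norms cancel (κ/T)², leaving B κ² < 1.
    calc D * (‖intVec z‖ * ‖intVec z'‖ * |QuadraticMap.polar Q u u'|)
        ≤ D * (((n + 1) * T) * ((n + 1) * T) * (2 * C * (κ / T) ^ 2)) := by
          gcongr
          exact habs.trans (by gcongr)
      _ = B * κ * κ := by rw [hB]; field_simp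
      _ < 1 := by nlinarith
  have ha0 : a = 0 := by
    rw [← Int.cast_abs] at hsmall
    exact Int.abs_lt_one_iff.mp (by exact_mod_cast hsmall)
  rw [ha0, Int.cast_zero] at ha
  exact (mul_eq_zero.mp ha).resolve_left hD.ne'

/-- Pairwise orthogonal isotropic integer vectors span a subspace of dimension at most the
`ℚ`-rank. -/
theorem finrank_span_intVec_le {m : ℕ} (Q : QuadraticForm ℝ (Vec m)) (G : Set (Fin m → ℤ))
    (hG : ∀ z ∈ G, ∀ z' ∈ G, QuadraticMap.polar Q (intVec z) (intVec z') = 0) :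
    Module.finrank ℝ (Submodule.span ℝ (intVec '' G)) ≤ rankQ Q := by
  refine (rankQ_attained Q).2 ⟨_, ⟨(fun z i => (z i : ℚ)) '' G, ?_⟩, ?_, rfl⟩
  · rw [Set.image_image]
    exact congrArg _ (Set.image_congr fun z _ => by simp [intVec])
  · intro v hv
    -- Bilinearity extends orthogonality from the generators to the span; on the diagonal the polar
    -- form is 2Q.
    have h := LinearMap.BilinMap.apply_apply_mem_of_mem_span (⊥ : Submodule ℝ ℝ) (intVec '' G)
      (intVec '' G) (QuadraticMap.polarBilin Q) (by
        rintro _ ⟨z, hz, rfl⟩ _ ⟨z', hz', rfl⟩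
        simpa using hG z hz z' hz') v v hv hv
    simpa using h

end QuadricApprox

namespace QuadricApprox

/-! ### Reduction to Lipschitz images of cubes -/

theorem exists_lipschitzWith_affineParam {n : ℕ} (i : Fin (n + 1)) :
    ∃ K, LipschitzWith K (affineParam i : (Fin n → ℝ) → ProjSpace n) := by
  let g : (Fin n → ℝ) → Vec (n + 1) := fun y =>
    WithLp.toLp 2 (i.insertNth (1 : ℝ) y : Fin (n + 1) → ℝ)
  have hg1 : ∀ y, 1 ≤ ‖g y‖ := by
    intro y
    have := PiLp.norm_apply_le (g y) i
    simpa [g] using this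
  have hins : LipschitzWith 1
      (fun y : Fin n → ℝ => (i.insertNth (1 : ℝ) y : Fin (n + 1) → ℝ)) := by
    refine LipschitzWith.of_dist_le_mul fun x y => ?_
    rw [NNReal.coe_one, one_mul, dist_pi_le_iff dist_nonneg]
    intro j
    rcases i.eq_self_or_eq_succAbove j with rfl | ⟨l, rfl⟩
    · simp
    · simpa using dist_le_pi_dist x y l
  have hg : LipschitzWith _ g := (PiLp.lipschitzWith_toLp 2 (fun _ : Fin (n + 1) => ℝ)).comp hins
  have h := lipschitzOnWith_toProj.comp (hg.lipschitzOnWith (s := Set.univ)) fun y _ => hg1 y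
  suffices hfun : affineParam i = toProj ∘ g from
    ⟨_, hfun ▸ lipschitzOnWith_univ.mp h⟩
  funext y
  have h0 : g y ≠ 0 := norm_pos_iff.mp (by linarith [hg1 y])
  rw [Function.comp_apply, toProj_of_ne_zero h0]
  rfl

open Topology in
/-- Around each of its points, a `k`-dimensional submanifold is contained in a Lipschitz image of
a cube of `ℝ^k`. -/
theorem IsSmoothSubmanifold.exists_lipschitzOnWith {E : Type*} [NormedAddCommGroup E]
    [NormedSpace ℝ E] [FiniteDimensional ℝ E] {k : ℕ} {S : Set E} (hS : IsSmoothSubmanifold k S)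
    {p : E} (hp : p ∈ S) :
    ∃ U ∈ 𝓝 p, ∃ (f : (Fin k → ℝ) → E) (K : NNReal) (R : ℝ), 0 ≤ R ∧
      LipschitzOnWith K f (Metric.closedBall 0 R) ∧ S ∩ U ⊆ f '' Metric.closedBall 0 R := by
  obtain ⟨e, V, hpe, -, hsymm, hfin, hV⟩ := hS p hp
  have hep : e p ∈ e.target := e.map_source hpe
  have hepV : e p ∈ V := (hV p hpe).mp hp
  have hcd : ContDiffAt ℝ 1 e.symm (e p) :=
    (hsymm.contDiffAt (e.open_target.mem_nhds hep)).of_le (by exact_mod_cast le_top)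
  obtain ⟨K, t, ht, hK⟩ := hcd.exists_lipschitzOnWith
  obtain ⟨ε, hε, hεt⟩ := Metric.mem_nhds_iff.mp ht
  let φ : (Fin k → ℝ) ≃L[ℝ] V := ContinuousLinearEquiv.ofFinrankEq (by simp [hfin])
  let h : (Fin k → ℝ) → E := fun c => e p + (φ c : E)
  have hh : LipschitzWith ‖(φ : (Fin k → ℝ) →L[ℝ] V)‖₊ h := by
    refine LipschitzWith.of_dist_le_mul fun c c' => ?_
    have := (φ : (Fin k → ℝ) →L[ℝ] V).lipschitz.dist_le_mul c c'
    simpa [h, dist_add_left, Subtype.dist_eq] using this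
  set a : ℝ := ‖(φ : (Fin k → ℝ) →L[ℝ] V)‖ with ha
  set a' : ℝ := ‖(φ.symm : V →L[ℝ] (Fin k → ℝ))‖ with ha'
  have ha0 : 0 ≤ a := ContinuousLinearMap.opNorm_nonneg _
  have ha0' : 0 ≤ a' := ContinuousLinearMap.opNorm_nonneg _
  -- Small enough for `h` to map the cube into the ball where `e.symm` is Lipschitz; the +1 avoids
  -- division by zero.
  set R : ℝ := ε / (a + 1) with hR
  have hR0 : 0 < R := by positivity
  have hmaps : Set.MapsTo h (Metric.closedBall 0 R) t := by
    intro c hc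
    refine hεt ?_
    have h1 : ‖φ c‖ ≤ a * ‖c‖ := (φ : (Fin k → ℝ) →L[ℝ] V).le_opNorm c
    have h2 : ‖c‖ ≤ R := by simpa using hc
    have h3 : (a + 1) * R = ε := mul_div_cancel₀ _ (by positivity)
    rw [Metric.mem_ball, dist_eq_norm, add_sub_cancel_left, Submodule.norm_coe]
    nlinarith
  have hcont : ContinuousAt e p := e.continuousAt hpe
  -- This radius makes the `φ`-coordinates of e x - e p fall in the cube of radius R.
  have hU : {x | x ∈ e.source ∧ dist (e x) (e p) < R / (a' + 1)} ∈ 𝓝 p :=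
    Filter.inter_mem (e.open_source.mem_nhds hpe)
      (hcont (Metric.ball_mem_nhds (e p) (by positivity)))
  refine ⟨_, hU, e.symm ∘ h, _, R, hR0.le, hK.comp hh.lipschitzOnWith hmaps, ?_⟩
  rintro x ⟨hxS, hxe, hx⟩
  have hxV : e x - e p ∈ V := V.sub_mem ((hV x hxe).mp hxS) hepV
  refine ⟨φ.symm ⟨e x - e p, hxV⟩, ?_, ?_⟩
  · have h1 := (φ.symm : V →L[ℝ] (Fin k → ℝ)).le_opNorm ⟨e x - e p, hxV⟩
    rw [dist_eq_norm, lt_div_iff₀ (by positivity)] at hx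
    rw [mem_closedBall_zero_iff]
    refine h1.trans ?_
    rw [Submodule.coe_norm]
    simp only
    nlinarith [norm_nonneg (e x - e p)]
  · simp [h, e.left_inv hxe]

/-- To bound the Hausdorff dimension of a part of a submanifold it is enough to bound it on
Lipschitz images of cubes. -/
theorem IsSmoothProjSubmanifold.dimH_inter_le {n k : ℕ} {M : Set (ProjSpace n)}
    (hM : IsSmoothProjSubmanifold k M) (W : Set (ProjSpace n)) (s : ℝ≥0∞)
    (H : ∀ (f : (Fin k → ℝ) → ProjSpace n) (K : NNReal) (R : ℝ), 0 ≤ R →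
      LipschitzOnWith K f (Metric.closedBall 0 R) →
      dimH (f '' Metric.closedBall 0 R ∩ W) ≤ s) :
    dimH (M ∩ W) ≤ s := by
  have hcover : M ∩ W ⊆ ⋃ i : Fin (n + 1), affineParam i '' (affineParam i ⁻¹' M) ∩ W := by
    rintro x ⟨hx, hxW⟩
    obtain ⟨v, hv, -, rfl⟩ := exists_unit_rep x
    obtain ⟨i, hi⟩ : ∃ i, v i ≠ 0 := by
      by_contra! h
      exact hv (by ext i; exact h i)
    have hmk : affineParam i (fun j => (v i)⁻¹ * v (i.succAbove j)) = Projectivization.mk ℝ v hv := by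
      rw [affineParam, Projectivization.mk_eq_mk_iff']
      refine ⟨(v i)⁻¹, ?_⟩
      ext j
      rcases i.eq_self_or_eq_succAbove j with rfl | ⟨l, rfl⟩
      · simp [hi]
      · simp
    exact Set.mem_iUnion.mpr ⟨i, ⟨_, by rw [Set.mem_preimage, hmk]; exact hx, hmk⟩, hxW⟩
  refine (dimH_mono hcover).trans ?_
  rw [dimH_iUnion]
  refine iSup_le fun i => ?_
  obtain ⟨K', hK'⟩ := exists_lipschitzWith_affineParam i
  have hloc : ∀ p : Fin n → ℝ, ∃ U : Set (Fin n → ℝ), p ∈ affineParam i ⁻¹' M →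
      U ∈ nhdsWithin p (affineParam i ⁻¹' M) ∧
      dimH (affineParam i '' (affineParam i ⁻¹' M ∩ U) ∩ W) ≤ s := by
    intro p
    by_cases hp : p ∈ affineParam i ⁻¹' M
    · obtain ⟨U, hU, f, K, R, hR, hf, hsub⟩ := (hM i).exists_lipschitzOnWith hp
      refine ⟨U, fun _ => ⟨mem_nhdsWithin_of_mem_nhds hU, ?_⟩⟩
      refine le_trans (dimH_mono ?_) (H _ _ R hR (hK'.comp_lipschitzOnWith hf))
      rw [Set.image_comp]
      exact Set.inter_subset_inter_left _ (Set.image_mono hsub)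
    · exact ⟨∅, fun h => absurd h hp⟩
  choose U hU using hloc
  -- Hausdorff dimension is stable under countable unions only, so a Lindelöf cover is extracted.
  obtain ⟨t, htM, htc, ht⟩ := TopologicalSpace.countable_cover_nhdsWithin
    fun p hp => (hU p hp).1
  have hsub : affineParam i '' (affineParam i ⁻¹' M) ∩ W
      ⊆ ⋃ p ∈ t, affineParam i '' (affineParam i ⁻¹' M ∩ U p) ∩ W := by
    rintro _ ⟨⟨y, hy, rfl⟩, hW⟩
    obtain ⟨p, hp, hyp⟩ := Set.mem_iUnion₂.mp (ht hy)
    exact Set.mem_iUnion₂.mpr ⟨p, hp, ⟨y, ⟨hy, hyp⟩, rfl⟩, hW⟩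
  refine (dimH_mono hsub).trans ?_
  rw [dimH_bUnion htc]
  exact iSup₂_le fun p hp => (hU p (htM hp)).2

end QuadricApprox

namespace QuadricApprox

/-! ### Approximable points -/

/-- The points that are `T^{-b}`-close to an isotropic integer vector of size at most `2T`. -/
def nearRational {n : ℕ} (Q : QuadraticForm ℝ (Vec (n + 1))) (b T : ℝ) : Set (ProjSpace n) :=
  {x | ∃ (z : Fin (n + 1) → ℤ) (hz : intVec z ≠ 0), Q (intVec z) = 0 ∧
    (∀ i, |(z i : ℝ)| ≤ 2 * T) ∧ dist x (Projectivization.mk ℝ _ hz) ≤ T ^ (-b)}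

/-- As b lies strictly below the exponent, it is not in the set whose infimum is taken, so every
constant c fails. -/
theorem exists_close_of_mem_approximableSet {n : ℕ} {Q : QuadraticForm ℝ (Vec (n + 1))} {β b : ℝ}
    (hb : 0 < b) (hbβ : b < β) {x : ProjSpace n} (hx : x ∈ approximableSet Q β) {c : ℝ}
    (hc : 0 < c) : ∃ (z : Fin (n + 1) → ℤ) (hz : intVec z ≠ 0), Q (intVec z) = 0 ∧
      dist x (Projectivization.mk ℝ _ hz) < c * (height z : ℝ) ^ (-b) := by
  have hna : ¬ NotApproximable Q b x := by
    intro h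
    have h1 : exponent Q x ≤ ENNReal.ofReal b := sInf_le ⟨b, ⟨hb, h⟩, rfl⟩
    have h2 := hx.2.trans h1
    rw [ENNReal.ofReal_le_ofReal_iff hb.le] at h2
    linarith
  unfold NotApproximable at hna
  push Not at hna
  obtain ⟨v, ⟨w, hw, hvw, hQw⟩, z, ⟨-, hz, rfl⟩, hd⟩ := hna c hc
  refine ⟨z, hz, ?_, hd⟩
  obtain ⟨a, ha⟩ := (Projectivization.mk_eq_mk_iff' ℝ _ _ hz hw).mp hvw
  change Q (WithLp.toLp 2 fun i => (z i : ℝ)) = 0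
  rw [← ha, QuadraticMap.map_smul, hQw, smul_zero]

theorem abs_le_height {n : ℕ} (z : Fin (n + 1) → ℤ) (i : Fin (n + 1)) :
    |z i| ≤ (height z : ℤ) := by
  rw [Int.abs_eq_natAbs]
  exact_mod_cast Finset.le_sup (f := fun i => (z i).natAbs) (Finset.mem_univ i)

theorem height_pos {n : ℕ} {z : Fin (n + 1) → ℤ} (hz : intVec z ≠ 0) : 0 < height z := by
  rw [Nat.pos_iff_ne_zero]
  intro h
  refine hz ?_
  ext i
  have := abs_le_height z i
  rw [h, Nat.cast_zero, abs_nonpos_iff] at this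
  simp [intVec, this]

theorem countable_setOf_rational {n : ℕ} :
    {x : ProjSpace n | ∃ (z : Fin (n + 1) → ℤ) (hz : intVec z ≠ 0),
      x = Projectivization.mk ℝ _ hz}.Countable := by
  refine (Set.countable_range fun z : Fin (n + 1) → ℤ => toProj (intVec z)).mono ?_
  rintro x ⟨z, hz, rfl⟩
  exact ⟨z, toProj_of_ne_zero hz⟩

-- An irrational x has positive distance to the finitely many rational points of height below 2^J.
-- Taking c below that distance forces an approximation of height at least 2^J.
open Filter Topology in
theorem frequently_mem_nearRational {n : ℕ} {Q : QuadraticForm ℝ (Vec (n + 1))} {β b : ℝ}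
    (hb : 0 < b) (hbβ : b < β) {x : ProjSpace n} (hx : x ∈ approximableSet Q β)
    (hxQ : ∀ (z : Fin (n + 1) → ℤ) (hz : intVec z ≠ 0), x ≠ Projectivization.mk ℝ _ hz) :
    ∃ᶠ j : ℕ in atTop, x ∈ nearRational Q b (2 ^ j) := by
  rw [frequently_atTop]
  intro J
  have hfin : {z : Fin (n + 1) → ℤ | height z < 2 ^ J}.Finite := by
    refine (Set.finite_Icc (fun _ => -(2 ^ J : ℤ)) (fun _ => (2 ^ J : ℤ))).subset ?_
    intro z hz
    have h1 : (height z : ℤ) ≤ 2 ^ J := by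
      exact_mod_cast (show height z < 2 ^ J from hz).le
    exact ⟨fun i => (abs_le.mp ((abs_le_height z i).trans h1)).1,
      fun i => (abs_le.mp ((abs_le_height z i).trans h1)).2⟩
  have hev : ∀ᶠ c : ℝ in 𝓝[>] 0, ∀ z ∈ {z : Fin (n + 1) → ℤ | height z < 2 ^ J},
      ∀ hz : intVec z ≠ 0, c ≤ dist x (Projectivization.mk ℝ _ hz) := by
    refine (eventually_all_finite hfin).mpr fun z _ => ?_
    by_cases hz : intVec z = 0
    · exact Eventually.of_forall fun c h => absurd hz h
    · filter_upwards [Ioo_mem_nhdsGT (dist_pos.mpr (hxQ z hz))] with c hc _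
      exact hc.2.le
  obtain ⟨c, hcF, hc0, hc1⟩ := (hev.and (Ioo_mem_nhdsGT (zero_lt_one' ℝ))).exists
  obtain ⟨z, hz, hQz, hd⟩ := exists_close_of_mem_approximableSet hb hbβ hx hc0
  have hH := height_pos hz
  have hH1 : (1 : ℝ) ≤ height z := by exact_mod_cast hH
  have hHb : (height z : ℝ) ^ (-b) ≤ 1 := Real.rpow_le_one_of_one_le_of_nonpos hH1 (by linarith)
  have hJ : 2 ^ J ≤ height z := by
    by_contra! h
    have h1 := hcF z h hz
    nlinarith
  -- Dyadic rounding: 2^j ≤ height < 2^(j+1), whence the factor 2 in `nearRational`.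
  refine ⟨Nat.log 2 (height z), Nat.le_log_of_pow_le one_lt_two hJ, z, hz, hQz, fun i => ?_, ?_⟩
  · have h1 : height z < 2 ^ (Nat.log 2 (height z) + 1) := Nat.lt_pow_succ_log_self one_lt_two _
    have h2 : |(z i : ℝ)| ≤ height z := by exact_mod_cast abs_le_height z i
    have h3 : (height z : ℝ) ≤ 2 ^ (Nat.log 2 (height z) + 1) := by exact_mod_cast h1.le
    rw [pow_succ'] at h3
    exact h2.trans h3
  · have h1 : ((2 : ℝ) ^ Nat.log 2 (height z)) ≤ height z := by
      exact_mod_cast Nat.pow_log_le_self 2 hH.ne'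
    have h2 : (height z : ℝ) ^ (-b) ≤ ((2 : ℝ) ^ Nat.log 2 (height z)) ^ (-b) :=
      Real.rpow_le_rpow_of_nonpos (by positivity) h1 (by linarith)
    have h3 : 0 ≤ (height z : ℝ) ^ (-b) := by positivity
    nlinarith

/-- In a set whose diameter is small compared to `1 / T`, the points that are close to rational
points of height about `T` lie near a projective subspace of dimension less than the `ℚ`-rank. -/
theorem coveredBy_nearRational_inter {n : ℕ} {Q : QuadraticForm ℝ (Vec (n + 1))} {κ : ℝ}
    (hκ0 : 0 < κ) (hκ1 : κ ≤ 1 / 2)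
    (hκ : ∀ T : ℝ, 1 ≤ T → ∀ z z' : Fin (n + 1) → ℤ,
      (∀ i, |(z i : ℝ)| ≤ T) → (∀ i, |(z' i : ℝ)| ≤ T) → Q (intVec z) = 0 → Q (intVec z') = 0 →
      ∀ (hz : intVec z ≠ 0) (hz' : intVec z' ≠ 0),
      dist (Projectivization.mk ℝ _ hz) (Projectivization.mk ℝ _ hz') ≤ κ / T →
      QuadraticMap.polar Q (intVec z) (intVec z') = 0)
    {b T : ℝ} (hT : 1 ≤ T) (hTb : T ^ (-b) ≤ κ / (8 * T)) (t : Set (ProjSpace n))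
    (ht : ∀ x ∈ t, ∀ y ∈ t, dist x y ≤ κ / (4 * T)) :
    CoveredBy (⌈T ^ (b - 1)⌉₊ ^ (rankQ Q - 1)) ((4 * n + 6) * T ^ (-b))
      (nearRational Q b T ∩ t) := by
  have hT0 : 0 < T := by linarith
  rcases (nearRational Q b T ∩ t).eq_empty_or_nonempty with h0 | ⟨x₀, ⟨z₀, hz₀, hQz₀, hzT₀, hd₀⟩, hxt₀⟩
  · rw [h0]
    exact ⟨∅, by simp, by simp, by simp⟩
  set G : Set (Fin (n + 1) → ℤ) := {z | ∃ hz : intVec z ≠ 0, Q (intVec z) = 0 ∧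
    (∀ i, |(z i : ℝ)| ≤ 2 * T) ∧ ∃ x ∈ t, dist x (Projectivization.mk ℝ _ hz) ≤ T ^ (-b)} with hG
  -- The budget κ/8 + κ/4 + κ/8 = κ/2 is the gap threshold for vectors of size 2T.
  have hclose : ∀ z z' : Fin (n + 1) → ℤ, ∀ (hz : intVec z ≠ 0) (hz' : intVec z' ≠ 0),
      (∃ x ∈ t, dist x (Projectivization.mk ℝ _ hz) ≤ T ^ (-b)) →
      (∃ x ∈ t, dist x (Projectivization.mk ℝ _ hz') ≤ T ^ (-b)) →
      dist (Projectivization.mk ℝ _ hz) (Projectivization.mk ℝ _ hz') ≤ κ / (2 * T) := by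
    rintro z z' hz hz' ⟨x, hx, hxz⟩ ⟨x', hx', hxz'⟩
    have h1 := dist_triangle4 (Projectivization.mk ℝ _ hz) x x' (Projectivization.mk ℝ _ hz')
    rw [dist_comm _ x] at h1
    have h2 := ht x hx x' hx'
    have h3 : κ / (2 * T) = κ / (8 * T) + κ / (4 * T) + κ / (8 * T) := by
      field_simp
      norm_num
    linarith
  have hpolar : ∀ z ∈ G, ∀ z' ∈ G, QuadraticMap.polar Q (intVec z) (intVec z') = 0 := by
    rintro z ⟨hz, hQz, hzT, hx⟩ z' ⟨hz', hQz', hzT', hx'⟩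
    exact hκ (2 * T) (by linarith) z z' hzT hzT' hQz hQz' hz hz' (hclose z z' hz hz' hx hx')
  have hz₀G : z₀ ∈ G := ⟨hz₀, hQz₀, hzT₀, x₀, hxt₀, hd₀⟩
  set E := Submodule.span ℝ (intVec '' G) with hE
  have hrank : Module.finrank ℝ E ≤ rankQ Q := finrank_span_intVec_le Q G hpolar
  have hu1 : ‖(‖intVec z₀‖⁻¹ • intVec z₀ : Vec (n + 1))‖ = 1 := norm_smul_inv_norm hz₀
  have hu0 : (‖intVec z₀‖⁻¹ • intVec z₀ : Vec (n + 1)) ≠ 0 := norm_pos_iff.mp (by linarith)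
  have huE : (‖intVec z₀‖⁻¹ • intVec z₀ : Vec (n + 1)) ∈ E :=
    E.smul_mem _ (Submodule.subset_span ⟨z₀, hz₀G, rfl⟩)
  have hmk : Projectivization.mk ℝ _ hu0 = Projectivization.mk ℝ _ hz₀ := by
    rw [Projectivization.mk_eq_mk_iff']
    exact ⟨_, rfl⟩
  have hpow : 0 < T ^ (b - 1) := Real.rpow_pos_of_pos hT0 _
  have hN : 0 < ⌈T ^ (b - 1)⌉₊ := Nat.ceil_pos.mpr hpow
  have hρ : κ / (2 * T) ≤ 1 / 2 := by
    rw [div_le_div_iff₀ (by positivity) (by norm_num)]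
    nlinarith
  -- About T^(b-1) cuts per direction reduce the scale 1/T to T^(-b); thickening by T^(-b) then adds
  -- 2 to 4(n+1), giving 4n + 6.
  have hcov := coveredBy_subspace E _ huE hu1 hu0 _ hN (κ / (2 * T)) (by positivity) hρ
  refine (hcov.thicken (T ^ (-b))).mono (Nat.pow_le_pow_right hN (by omega)) ?_ ?_
  · have h1 : κ / (2 * T) / (⌈T ^ (b - 1)⌉₊ : ℝ) ≤ T ^ (-b) := by
      have h2 : T ^ (b - 1) ≤ (⌈T ^ (b - 1)⌉₊ : ℝ) := Nat.le_ceil _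
      have h3 : T ^ (-b) * T ^ (b - 1) = T⁻¹ := by
        rw [← Real.rpow_add hT0, ← Real.rpow_neg_one]
        congr 1
        ring
      have h4 : κ / (2 * T) ≤ T⁻¹ := by
        rw [inv_eq_one_div, div_le_div_iff₀ (by positivity) hT0]
        nlinarith
      rw [div_le_iff₀ (by exact_mod_cast hN)]
      calc κ / (2 * T) ≤ T⁻¹ := h4
        _ = T ^ (-b) * T ^ (b - 1) := h3.symm
        _ ≤ _ := by gcongr
    have h5 : 4 * ((n : ℝ) + 1) * (κ / (2 * T) / (⌈T ^ (b - 1)⌉₊ : ℝ))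
        ≤ 4 * ((n : ℝ) + 1) * T ^ (-b) := by gcongr
    linarith
  · rintro x ⟨⟨z, hz, hQz, hzT, hd⟩, hxt⟩
    refine ⟨_, ⟨intVec z, Submodule.subset_span ⟨z, ⟨hz, hQz, hzT, x, hxt, hd⟩, rfl⟩, hz, rfl, ?_⟩,
      hd⟩
    rw [hmk]
    exact hclose z z₀ hz hz₀ ⟨x, hxt, hd⟩ ⟨x₀, hxt₀, hd₀⟩

open Filter Topology in
/-- The Hausdorff dimension of the points of a Lipschitz image of a cube that are infinitely often
close to rational points. -/
theorem dimH_frequently_nearRational_le {n k : ℕ} {Q : QuadraticForm ℝ (Vec (n + 1))}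
    (hQ : IsRationalForm Q) (hr : 1 ≤ rankQ Q) {b s : ℝ} (hb : 1 < b)
    (hs : k + (b - 1) * ((rankQ Q : ℝ) - 1) < b * s)
    {f : (Fin k → ℝ) → ProjSpace n} {K : NNReal} {R : ℝ} (hR : 0 ≤ R)
    (hf : LipschitzOnWith K f (Metric.closedBall 0 R)) :
    dimH {x ∈ f '' Metric.closedBall 0 R | ∃ᶠ j : ℕ in atTop, x ∈ nearRational Q b (2 ^ j)}
      ≤ ENNReal.ofReal s := by
  obtain ⟨κ, hκ0, hκ1, hκ⟩ := hQ.exists_polar_eq_zero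
  have hr' : (0 : ℝ) ≤ (rankQ Q : ℝ) - 1 := sub_nonneg.mpr (by exact_mod_cast hr)
  have hs0 : 0 ≤ s := by
    by_contra! h
    have h1 : (0 : ℝ) ≤ k := Nat.cast_nonneg k
    have h2 : 0 ≤ (b - 1) * ((rankQ Q : ℝ) - 1) := mul_nonneg (by linarith) hr'
    nlinarith
  set a : ℝ := 8 * R * K / κ + 2 with ha
  have ha0 : 0 < a := by positivity
  set m : ℕ := rankQ Q - 1 with hm
  have hm' : (rankQ Q : ℝ) - 1 = m := by rw [hm, Nat.cast_sub hr, Nat.cast_one]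
  set q : ℝ := 2 ^ (-b) with hq
  have hq0 : 0 < q := by positivity
  have hq1 : q < 1 := Real.rpow_lt_one_of_one_lt_of_neg one_lt_two (by linarith)
  have hTq : ∀ j : ℕ, ((2 : ℝ) ^ j) ^ (-b) = q ^ j := fun j => by
    rw [hq, Real.rpow_pow_comm (by norm_num)]
  -- Chosen so that K · 2R/N₁ ≤ κ/(4 · 2^j); the +1 keeps it positive.
  let N₁ : ℕ → ℕ := fun j => ⌈8 * R * K / κ * 2 ^ j⌉₊ + 1
  let N₂ : ℕ → ℕ := fun j => ⌈((2 : ℝ) ^ j) ^ (b - 1)⌉₊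
  have hT1 : ∀ j : ℕ, (1 : ℝ) ≤ 2 ^ j := fun j => one_le_pow₀ one_le_two
  have hN₁ : ∀ j, (N₁ j : ℝ) ≤ a * 2 ^ j := by
    intro j
    have h1 := (Nat.ceil_lt_add_one (show 0 ≤ 8 * R * K / κ * 2 ^ j by positivity)).le
    simp only [N₁, ha]
    push_cast
    linarith [hT1 j]
  have hN₂ : ∀ j, (N₂ j : ℝ) ≤ 2 * (2 ^ (b - 1)) ^ j := by
    intro j
    have h1 : (1 : ℝ) ≤ ((2 : ℝ) ^ j) ^ (b - 1) := Real.one_le_rpow (hT1 j) (by linarith)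
    have h2 := (Nat.ceil_lt_add_one (show 0 ≤ ((2 : ℝ) ^ j) ^ (b - 1) by positivity)).le
    rw [Real.rpow_pow_comm (by norm_num)]
    simp only [N₂]
    linarith
  refine dimH_le_of_frequently_mem (N := fun j => N₁ j ^ k * N₂ j ^ m)
    (δ := fun j => (4 * n + 6) * q ^ j) hs0 (fun j => by positivity) ?_ ?_ ?_
    (fun j => f '' Metric.closedBall 0 R ∩ nearRational Q b (2 ^ j)) ?_ ?_
  · intro i j hij
    exact mul_le_mul_of_nonneg_left (pow_le_pow_of_le_one hq0.le hq1.le hij) (by positivity)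
  · simpa using (tendsto_pow_atTop_nhds_zero_of_lt_one hq0.le hq1).const_mul (4 * (n : ℝ) + 6)
  -- Ratio of the dominating geometric series; `hs` says exactly that its exponent of 2 is negative.
  · set θ : ℝ := 2 ^ k * (2 ^ (b - 1)) ^ m * q ^ s with hθ
    have hθ0 : 0 ≤ θ := by positivity
    have hθ1 : θ < 1 := by
      have h1 : θ = 2 ^ ((k : ℝ) + (b - 1) * m + -b * s) := by
        rw [Real.rpow_add two_pos, Real.rpow_add two_pos, Real.rpow_natCast, Real.rpow_mul two_pos.le,
          Real.rpow_natCast, Real.rpow_mul two_pos.le]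
      rw [h1]
      refine Real.rpow_lt_one_of_one_lt_of_neg one_lt_two ?_
      rw [hm'] at hs
      linarith
    refine Summable.of_nonneg_of_le (fun j => by positivity) (fun j => ?_)
      ((summable_geometric_of_lt_one hθ0 hθ1).mul_left (a ^ k * 2 ^ m * (4 * n + 6) ^ s))
    have h1 : ((N₁ j ^ k * N₂ j ^ m : ℕ) : ℝ) ≤ (a * 2 ^ j) ^ k * (2 * (2 ^ (b - 1)) ^ j) ^ m := by
      push_cast
      gcongr
      · exact hN₁ j
      · exact hN₂ j
    have h2 : ((4 * n + 6) * q ^ j) ^ s = (4 * n + 6) ^ s * (q ^ s) ^ j := by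
      rw [Real.mul_rpow (by positivity) (by positivity), Real.rpow_pow_comm hq0.le]
    rw [h2]
    refine (mul_le_mul_of_nonneg_right h1 (by positivity)).trans (le_of_eq ?_)
    rw [hθ]
    simp only [mul_pow, ← pow_mul]
    rw [mul_comm j k, mul_comm j m]
    ring
  -- As b > 1, the error T^(-b) eventually drops below κ/(8T).
  · have hlim : Tendsto (fun j : ℕ => ((2 : ℝ) ^ (1 - b)) ^ j) atTop (𝓝 0) :=
      tendsto_pow_atTop_nhds_zero_of_lt_one (by positivity)
        (Real.rpow_lt_one_of_one_lt_of_neg one_lt_two (by linarith))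
    filter_upwards [hlim.eventually_le_const (show 0 < κ / 8 by positivity)] with j hj
    have hT0 : (0 : ℝ) < 2 ^ j := by positivity
    have hTb : ((2 : ℝ) ^ j) ^ (-b) ≤ κ / (8 * 2 ^ j) := by
      rw [← Real.rpow_pow_comm two_pos.le, show -b = 1 - b - 1 by ring,
        Real.rpow_sub_one two_ne_zero, div_pow, ← div_div]
      gcongr
    have hcov := (coveredBy_closedBall_pi k (N₁ j) (Nat.succ_pos _) R hR).image hf
    have hcov' : CoveredBy (N₁ j ^ k) (κ / (4 * 2 ^ j)) (f '' Metric.closedBall 0 R) := by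
      refine hcov.mono le_rfl ?_ le_rfl
      have h1 : 8 * R * K / κ * 2 ^ j ≤ (N₁ j : ℝ) := by
        refine (Nat.le_ceil _).trans ?_
        simp [N₁]
      have h2 : (0 : ℝ) < N₁ j := by exact_mod_cast Nat.succ_pos _
      rw [div_mul_eq_mul_div, div_le_iff₀ hκ0] at h1
      rw [← mul_div_assoc, div_le_div_iff₀ h2 (by positivity)]
      linarith
    refine hcov'.refine Set.inter_subset_left fun t ht => ?_
    have h3 := coveredBy_nearRational_inter hκ0 hκ1 hκ (hT1 j) hTb t ht
    rw [hTq] at h3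
    exact h3.mono le_rfl le_rfl fun x hx => ⟨hx.1.2, hx.2⟩
  · rintro x ⟨hx, hfreq⟩
    exact hfreq.mono fun j hj => ⟨hx, hj⟩

/-- A point with positive exponent has some rational point of the quadric as an approximation, and
that point spans an isotropic rational line. This makes the natural subtraction `rankQ Q - 1`
genuine. -/
theorem one_le_rankQ {n : ℕ} {Q : QuadraticForm ℝ (Vec (n + 1))} {β : ℝ} (hβ : 0 < β)
    (h : (approximableSet Q β).Nonempty) : 1 ≤ rankQ Q := by
  obtain ⟨x, hx⟩ := h
  obtain ⟨z, hz, hQz, -⟩ := exists_close_of_mem_approximableSet (half_pos hβ) (half_lt_self hβ) hx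
    one_pos
  have h1 := finrank_span_intVec_le Q {z} (by
    rintro _ rfl _ rfl
    rw [QuadraticMap.polar_self, hQz, smul_zero])
  rwa [Set.image_singleton, finrank_span_singleton hz] at h1

open Filter Topology in
theorem dimH_image_inter_approximableSet_le {n k : ℕ} {Q : QuadraticForm ℝ (Vec (n + 1))}
    (hQ : IsRationalForm Q) (hr : 1 ≤ rankQ Q) (hk : rankQ Q ≤ k) {β : ℝ} (hβ : 0 < β)
    {f : (Fin k → ℝ) → ProjSpace n} {K : NNReal} {R : ℝ} (hR : 0 ≤ R)
    (hf : LipschitzOnWith K f (Metric.closedBall 0 R)) :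
    dimH (f '' Metric.closedBall 0 R ∩ approximableSet Q β) ≤
      ENNReal.ofReal ((k : ℝ) - ((k : ℝ) + 1 - (rankQ Q : ℝ)) * (1 - 1 / β)) := by
  have hk' : (rankQ Q : ℝ) ≤ k := by exact_mod_cast hk
  have hr' : (1 : ℝ) ≤ rankQ Q := by exact_mod_cast hr
  rcases le_or_gt β 1 with h1 | h1
  · have hle : (k : ℝ) ≤ (k : ℝ) - ((k : ℝ) + 1 - (rankQ Q : ℝ)) * (1 - 1 / β) := by
      have : 1 ≤ 1 / β := (one_le_div hβ).mpr h1
      nlinarith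
    calc dimH (f '' Metric.closedBall 0 R ∩ approximableSet Q β)
        ≤ dimH (f '' Metric.closedBall 0 R) := dimH_mono Set.inter_subset_left
      _ ≤ dimH (Metric.closedBall (0 : Fin k → ℝ) R) := hf.dimH_image_le
      _ ≤ dimH (Set.univ : Set (Fin k → ℝ)) := dimH_mono (Set.subset_univ _)
      _ = k := Real.dimH_univ_pi_fin k
      _ = ENNReal.ofReal k := (ENNReal.ofReal_natCast k).symm
      _ ≤ _ := ENNReal.ofReal_le_ofReal hle
  set s₀ : ℝ := (k : ℝ) - ((k : ℝ) + 1 - (rankQ Q : ℝ)) * (1 - 1 / β) with hs₀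
  have hlim : Tendsto ENNReal.ofReal (𝓝[>] s₀) (𝓝 (ENNReal.ofReal s₀)) :=
    (ENNReal.continuous_ofReal.tendsto s₀).mono_left nhdsWithin_le_nhds
  -- It suffices to treat every s > s₀; the slack leaves room for some b < β.
  refine ge_of_tendsto hlim ?_
  filter_upwards [self_mem_nhdsWithin] with s hs
  have hs : s₀ < s := hs
  have hpos : 0 < (k : ℝ) + 1 - rankQ Q := by linarith
  have hσ : ((k : ℝ) + 1 - rankQ Q) / β < s - (rankQ Q - 1) := by
    have : s₀ = (rankQ Q - 1) + ((k : ℝ) + 1 - rankQ Q) / β := by rw [hs₀]; ring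
    linarith
  have hσ0 : 0 < s - (rankQ Q - 1) := lt_trans (by positivity) hσ
  have hlt : ((k : ℝ) + 1 - rankQ Q) / (s - (rankQ Q - 1)) < β := by
    rw [div_lt_iff₀ hβ] at hσ
    rw [div_lt_iff₀ hσ0]
    linarith
  -- The second lower bound on b is the convergence condition k + (b-1)(r-1) < b s solved for b.
  obtain ⟨b, hb, hbβ⟩ := exists_between (max_lt h1 hlt)
  obtain ⟨hb1, hb2⟩ := max_lt_iff.mp hb
  rw [div_lt_iff₀ hσ0] at hb2
  have hdim := dimH_frequently_nearRational_le (k := k) hQ hr hb1 (s := s) (by linarith) hR hf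
  have hsub : f '' Metric.closedBall 0 R ∩ approximableSet Q β ⊆
      {x ∈ f '' Metric.closedBall 0 R | ∃ᶠ j : ℕ in atTop, x ∈ nearRational Q b (2 ^ j)} ∪
      {x | ∃ (z : Fin (n + 1) → ℤ) (hz : intVec z ≠ 0), x = Projectivization.mk ℝ _ hz} := by
    rintro x ⟨hxf, hx⟩
    by_cases hxQ : ∃ (z : Fin (n + 1) → ℤ) (hz : intVec z ≠ 0), x = Projectivization.mk ℝ _ hz
    · exact Or.inr hxQ
    · push Not at hxQ
      exact Or.inl ⟨hxf, frequently_mem_nearRational (by linarith) hbβ hx hxQ⟩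
  refine (dimH_mono hsub).trans ?_
  rw [dimH_union, dimH_countable countable_setOf_rational]
  exact max_le hdim zero_le

end QuadricApprox

/-! ### Conclusion: the bound for submanifolds -/

theorem theorem2p2 (n : ℕ)
    (Q : QuadraticForm ℝ (QuadricApprox.Vec (n + 1))) (hQ : QuadricApprox.IsRationalForm Q)
    (k : ℕ) (hk : QuadricApprox.rankQ Q ≤ k)
    (M : Set (QuadricApprox.ProjSpace n)) (hM : QuadricApprox.IsSmoothProjSubmanifold k M)
    (hMX : M ⊆ QuadricApprox.quadric Q)
    (β : ℝ) (hβ : 0 < β)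
    (hne : (M ∩ QuadricApprox.approximableSet Q β).Nonempty) :
    ((dimH (M ∩ QuadricApprox.approximableSet Q β) : ℝ≥0∞) : EReal) ≤
      (((k : ℝ) - ((k : ℝ) + 1 - (QuadricApprox.rankQ Q : ℝ)) * (1 - 1 / β) : ℝ) : EReal) := by
  have hr := QuadricApprox.one_le_rankQ hβ (hne.mono Set.inter_subset_right)
  have hdim := hM.dimH_inter_le (QuadricApprox.approximableSet Q β) _ fun f K R hR hf =>
    QuadricApprox.dimH_image_inter_approximableSet_le hQ hr hk hβ hR hf
  refine (EReal.coe_ennreal_le_coe_ennreal_iff.mpr hdim).trans ?_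
  rw [EReal.coe_ennreal_ofReal, EReal.coe_le_coe_iff]
  -- The truncation at 0 in `ENNReal.ofReal` is harmless: the bound equals (r-1) + (k+1-r)/β with 1
  -- ≤ r ≤ k, so it is nonnegative.
  refine max_le le_rfl ?_
  have hk' : (QuadricApprox.rankQ Q : ℝ) ≤ k := by exact_mod_cast hk
  have hr' : (1 : ℝ) ≤ QuadricApprox.rankQ Q := by exact_mod_cast hr
  have hβ' : 0 < 1 / β := by positivity
  nlinarith
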